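/- Let $(R,\mathfrak m)$ be a one-dimensional Noetherian local domain of characteristic $p>0$ that is analytically irreducible, i.e. its $\mathfrak m$-adic completion is a domain. For an $\mathfrak m$-primary ideal $I$ let $e(I)=\lim_{n\to\infty}\ell_R(R/I^n)/n$ be its multiplicity (the limit exists and is a positive finite number). For an ideal $J$ and $q=p^e$ let $J^{[q]}$ be the ideal generated by the $q$-th powers of all elements of $J$. For $\mathfrak m$-primary ideals $\mathfrak a, J$ put $\nu_{\mathfrak a}^J(q)=\max\{r\in\mathbb N : \mathfrak a^r\not\subseteq J^{[q]}\}$, and let $$c_+^J(\mathfrak a)=\limsup_{q=p^e\to\infty}\frac{\nu_{\mathfrak a}^J(q)}{q},\qquad c_-^J(\mathfrak a)=\liminf_{q=p^e\to\infty}\frac{\nu_{\mathfrak a}^J(q)}{q}.$$ When these agree, their common value is the F-threshold $c^J(\mathfrak a)$. Then for all $\mathfrak m$-primary ideals $\mathfrak a$ and $J$ of $R$ the F-threshold $c^J(\mathfrak a)$ exists and $$c^J(\mathfrak a)=\frac{e(J)}{e(\mathfrak a)}.$$ In particular the multiplicity conjecture holds in $R$: with $d=\dim R=1$, if $J\subseteq\mathfrak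 m$ is an ideal generated by a full system of parameters (that is, by $d$ elements generating an ideal of height $d$) and $\mathfrak a\subseteq\mathfrak m$ is an $\mathfrak m$-primary ideal, then $$e(\mathfrak a)\ \ge\ \left(\frac{d}{c_-^J(\mathfrak a)}\right)^{d} e(J).$$ -/

import Mathlib

open Filter Topology
open scoped ENNReal

namespace FThresholds

noncomputable section

/-- The dimension of a (Noetherian local) ring as a natural number. -/
def dim (R : Type*) [CommRing R] : ℕ :=
  ((ringKrullDim R).unbotD 0).toNat

/-- `I` is primary to the maximal ideal of the local ring `R`. -/
def IsMPrimary {R : Type*} [CommRing R] [IsLocalRing R] (I : Ideal R) : Prop :=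
  I.IsPrimary ∧ I.radical = IsLocalRing.maximalIdeal R

/-- A local ring is analytically irreducible if its completion with respect to the maximal ideal
is a domain. -/
def IsAnalyticallyIrreducible (R : Type*) [CommRing R] [IsLocalRing R] : Prop :=
  IsDomain (AdicCompletion (IsLocalRing.maximalIdeal R) R)

/-- `I^[q]`: the ideal generated by the `q`-th powers of all elements of `I`. -/
def frobeniusPower {R : Type*} [CommRing R] (I : Ideal R) (q : ℕ) : Ideal R :=
  Ideal.span ((fun x : R => x ^ q) '' (I : Set R))

/-- `ν_𝔞^J(q) = max {r | 𝔞 ^ r ⊄ J^[q]}`. If `𝔞 ⊆ √J` and `R` is Noetherian, the set is bounded;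
the value is `0` if the set is empty. -/
def nu {R : Type*} [CommRing R] (𝔞 J : Ideal R) (q : ℕ) : ℕ :=
  sSup {r : ℕ | ¬ 𝔞 ^ r ≤ frobeniusPower J q}

/-- `c_+^J(𝔞)`, the limsup of `ν_𝔞^J(q) / q` over `q = p ^ e → ∞`. -/
def fThresholdUpper {R : Type*} [CommRing R] (p : ℕ) (𝔞 J : Ideal R) : ℝ≥0∞ :=
  limsup (fun e : ℕ => (nu 𝔞 J (p ^ e) : ℝ≥0∞) / (p ^ e : ℕ)) atTop

/-- `c_-^J(𝔞)`, the liminf of `ν_𝔞^J(q) / q` over `q = p ^ e → ∞`. -/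
def fThresholdLower {R : Type*} [CommRing R] (p : ℕ) (𝔞 J : Ideal R) : ℝ≥0∞ :=
  liminf (fun e : ℕ => (nu 𝔞 J (p ^ e) : ℝ≥0∞) / (p ^ e : ℕ)) atTop

/-- The F-threshold `c^J(𝔞)` exists and equals `c`, i.e. `c_+^J(𝔞) = c_-^J(𝔞) = c`. -/
def HasFThreshold {R : Type*} [CommRing R] (p : ℕ) (𝔞 J : Ideal R) (c : ℝ≥0∞) : Prop :=
  fThresholdUpper p 𝔞 J = c ∧ fThresholdLower p 𝔞 J = c

/-- The sequence `n ↦ d! · ℓ_R(R / I ^ n) / n ^ d`, where `d` is the dimension of `R`. -/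
def hilbertSamuelSeq {R : Type*} [CommRing R] (I : Ideal R) (n : ℕ) : ℝ≥0∞ :=
  ((dim R).factorial : ℝ≥0∞) * ((Module.length R (R ⧸ I ^ n) : ℕ∞) : ℝ≥0∞) / (n : ℝ≥0∞) ^ dim R

/-- The (Hilbert–Samuel) multiplicity `e(I) = lim_n d! · ℓ_R(R / I ^ n) / n ^ d`. -/
def mult {R : Type*} [CommRing R] (I : Ideal R) : ℝ≥0∞ :=
  limUnder atTop (hilbertSamuelSeq I)

/-- `J` is contained in the maximal ideal and is generated by a full system of parameters, that is
by `d = dim R` elements which generate an ideal of height `d`. -/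
def IsGeneratedByFullSOP {R : Type*} [CommRing R] [IsLocalRing R] (J : Ideal R) : Prop :=
  J ≤ IsLocalRing.maximalIdeal R ∧ J.height = (dim R : ℕ∞) ∧
    ∃ x : Fin (dim R) → R, J = Ideal.span (Set.range x)

/-- The multiplicity conjecture holds in the `d`-dimensional local ring `R`: if `J` is generated by
a full system of parameters and `𝔞` is primary to the maximal ideal,
then `e(𝔞) ≥ (d / c_-^J(𝔞)) ^ d · e(J)`. -/
def MultiplicityConjectureHolds (p : ℕ) (R : Type*) [CommRing R] [IsLocalRing R] : Prop :=
  ∀ 𝔞 J : Ideal R, IsMPrimary 𝔞 → IsGeneratedByFullSOP J →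
    ((dim R : ℝ≥0∞) / fThresholdLower p 𝔞 J) ^ dim R * mult J ≤ mult 𝔞

end

end FThresholds

/-! Let `A` be the completion, a domain, and `v` the valuation of a valuation ring of its fraction
field that dominates `A`. For a parameter `t` the ideals `v a ≤ v t ^ n` of `A` meet in zero, so by
Chevalley's theorem one of them lies in `t A`. Hence comparing values decides divisibility in `R` up
to one fixed factor `c` (`exists_dvd_or_dvd_mul`).

The length of `R / (x)` is additive on products. If `x` attains its minimum `minOrd I` on the
nonzero elements of `I`, then `(x ^ n) ≤ I ^ n ≤ (x ^ (n - k))` with `k` independent of `n`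
(`IsDvdBound.pow_le_span`), so `ℓ(R / I ^ n) = n * minOrd I + O(1)` and `e(I) = minOrd I`. Since
`J^[q]` is trapped in the same way, `ν(q) * e(𝔞) = q * e(J) + O(1)`. -/

namespace FThresholds

open IsLocalRing

/-! ### Chevalley's theorem -/

/-- Chevalley's theorem for open ideals of an adically complete ring. -/
theorem exists_le_pow_of_iInf_eq_bot {A : Type*} [CommRing A] (m : Ideal A) [IsPrecomplete m A]
    (hart : ∀ k, IsArtinianRing (A ⧸ m ^ k)) {I : ℕ → Ideal A} (hI : Antitone I)
    (hopen : ∀ n, ∃ k, m ^ k ≤ I n) (hinf : ∀ x, (∀ n, x ∈ I n) → x = 0) (k : ℕ) :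
    ∃ n, I n ≤ m ^ k := by
  by_contra! hk
  have hstab : ∀ j, ∃ N, ∀ n, N ≤ n → I N ⊔ m ^ j = I n ⊔ m ^ j := by
    intro j
    have := hart j
    obtain ⟨N, hN⟩ := IsArtinian.monotone_stabilizes (R := A ⧸ m ^ j) (M := A ⧸ m ^ j)
      ⟨fun n => OrderDual.toDual ((I n).map (Ideal.Quotient.mk (m ^ j))),
        fun a b hab => Ideal.map_mono (hI hab)⟩
    refine ⟨N, fun n hn => ?_⟩
    have h1 : (I N).map (Ideal.Quotient.mk (m ^ j)) = (I n).map (Ideal.Quotient.mk (m ^ j)) :=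
      hN n hn
    have h2 := congrArg (Ideal.comap (Ideal.Quotient.mk (m ^ j))) h1
    simpa [Ideal.comap_map_of_surjective' _ Ideal.Quotient.mk_surjective, Ideal.mk_ker] using h2
  choose N hN using hstab
  have hE : ∀ j x, x ∈ I (N j) ⊔ m ^ j → ∀ n, x ∈ I n ⊔ m ^ j := by
    intro j x hx n
    rcases le_total (N j) n with h | h
    · rwa [← hN j n h]
    · exact sup_le_sup_right (hI h) _ hx
  -- Stable images modulo powers of `m` let approximations be lifted: a start outside `m ^ k` grows
  -- into a Cauchy sequence that stays outside `m ^ k`.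
  have hstep : ∀ j (x : A), x ∈ I (N j) ⊔ m ^ j →
      ∃ y, y ∈ I (N (j + 1)) ⊔ m ^ (j + 1) ∧ y - x ∈ m ^ j := by
    intro j x hx
    obtain ⟨y, hy, z, hz, rfl⟩ := Submodule.mem_sup.mp (hE j x hx (N (j + 1)))
    exact ⟨y, Ideal.mem_sup_left hy, by simpa using neg_mem hz⟩
  obtain ⟨x₀, hx₀, hx₀k⟩ := Set.not_subset.mp (hk (N k))
  choose! f hf using hstep
  let x : ℕ → A := fun i => Nat.rec x₀ (fun i y => f (k + i) y) i
  have hx : ∀ i, x i ∈ I (N (k + i)) ⊔ m ^ (k + i) := by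
    intro i
    induction i with
    | zero => exact Ideal.mem_sup_left hx₀
    | succ i ih => exact (hf (k + i) (x i) ih).1
  have hxs : ∀ i, x (i + 1) - x i ∈ m ^ (k + i) := fun i => (hf (k + i) (x i) (hx i)).2
  have hxc : ∀ i l, x (i + l) - x i ∈ m ^ (k + i) := by
    intro i l
    induction l with
    | zero => simp
    | succ l ih =>
      have := Ideal.pow_le_pow_right (show k + i ≤ k + (i + l) by omega) (hxs (i + l))
      simpa [add_assoc] using add_mem this ih
  obtain ⟨L, hL⟩ := IsPrecomplete.prec (I := m) (M := A) inferInstance (f := x) (by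
    intro i j hij
    obtain ⟨l, rfl⟩ := Nat.exists_eq_add_of_le hij
    rw [SModEq.comm, SModEq.sub_mem]
    simpa using Ideal.pow_le_pow_right (Nat.le_add_left i k) (hxc i l))
  have hL' : ∀ i, x i - L ∈ m ^ i := by
    intro i
    simpa using SModEq.sub_mem.mp (hL i)
  -- Each `I n` is open, hence closed, so it contains the limit.
  have hL0 : L = 0 := by
    refine hinf L fun n => ?_
    obtain ⟨j, hj⟩ := hopen n
    have h1 := hE _ _ (hx j) n
    have h2 : I n ⊔ m ^ (k + j) ≤ I n :=
      sup_le le_rfl ((Ideal.pow_le_pow_right (Nat.le_add_left j k)).trans hj)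
    have := sub_mem (h2 h1) (hj (hL' j))
    simpa using this
  apply hx₀k
  have h1 := hxc 0 k
  have h2 := hL' k
  rw [hL0] at h2
  have := sub_mem h2 h1
  simpa [x] using this

/-! ### Passage between the ring and its completion -/

/-- In a one-dimensional Noetherian local domain, the principal ideal of a nonzero element
contains a power of the maximal ideal. -/
theorem exists_maximalIdeal_pow_le_span {R : Type*} [CommRing R] [IsDomain R] [IsLocalRing R]
    [IsNoetherianRing R] (hdim : ringKrullDim R = 1) {x : R} (hx : x ≠ 0) :
    ∃ k, maximalIdeal R ^ k ≤ Ideal.span {x} := by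
  have : Ring.KrullDimLE 1 R := by
    rw [Ring.KrullDimLE, Order.krullDimLE_iff]
    exact hdim.le
  have h := isFiniteLength_quotient_span_singleton R (mem_nonZeroDivisors_of_ne_zero hx)
  rw [isFiniteLength_iff_isNoetherian_isArtinian] at h
  have h2 := h.2
  have : IsArtinianRing (R ⧸ Ideal.span {x}) := isArtinian_of_tower R h2
  exact exists_maximalIdeal_pow_le_of_isArtinianRing_quotient _

/-- The properties of the completion `A` of a Noetherian local ring `R` that are used below. -/
structure IsLocalCompletion (R A : Type*) [CommRing R] [IsLocalRing R] [CommRing A]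
    [IsLocalRing A] [Algebra R A] : Prop where
  isPrecomplete : IsPrecomplete (maximalIdeal A) A
  isHausdorff : IsHausdorff (maximalIdeal A) A
  map_mem : ∀ {k : ℕ} {r : R}, r ∈ maximalIdeal R ^ k → algebraMap R A r ∈ maximalIdeal A ^ k
  mem_of_map_mem : ∀ {k : ℕ} {r : R},
    algebraMap R A r ∈ maximalIdeal A ^ k → r ∈ maximalIdeal R ^ k
  exists_sub_mem : ∀ (k : ℕ) (a : A), ∃ r : R, a - algebraMap R A r ∈ maximalIdeal A ^ k
  pow_eq_map : ∀ k, maximalIdeal A ^ k = (maximalIdeal R ^ k).map (algebraMap R A)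

theorem isLocalCompletion_adicCompletion (R : Type*) [CommRing R] [IsLocalRing R]
    [IsNoetherianRing R] : IsLocalCompletion R (AdicCompletion (maximalIdeal R) R) := by
  have hpow : ∀ k, maximalIdeal (AdicCompletion (maximalIdeal R) R) ^ k =
      (maximalIdeal R ^ k).map (algebraMap R (AdicCompletion (maximalIdeal R) R)) := by
    intro k
    rw [AdicCompletion.maximalIdeal_eq_map, Ideal.map_pow]
  have hker : ∀ k (a : AdicCompletion (maximalIdeal R) R),
      a ∈ maximalIdeal (AdicCompletion (maximalIdeal R) R) ^ k ↔
        AdicCompletion.eval (maximalIdeal R) R k a = 0 := by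
    intro k a
    rw [hpow, ← LinearMap.mem_ker, ← AdicCompletion.pow_smul_top_eq_ker_eval
      (maximalIdeal R).fg_of_isNoetherianRing, ← Submodule.restrictScalars_mem R,
      ← Ideal.smul_top_eq_map]
  have hof : ∀ k (r : R), AdicCompletion.eval (maximalIdeal R) R k
      (algebraMap R (AdicCompletion (maximalIdeal R) R) r) =
      Submodule.Quotient.mk r := fun k r => rfl
  have hmem : ∀ k (r : R), algebraMap R (AdicCompletion (maximalIdeal R) R) r ∈
      maximalIdeal (AdicCompletion (maximalIdeal R) R) ^ k ↔ r ∈ maximalIdeal R ^ k := by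
    intro k r
    rw [hker, hof, Submodule.Quotient.mk_eq_zero]
    simp
  refine ⟨inferInstance, inferInstance, (hmem _ _).2, (hmem _ _).1, fun k a => ?_, hpow⟩
  obtain ⟨r, hr⟩ := Submodule.Quotient.mk_surjective _ (AdicCompletion.eval (maximalIdeal R) R k a)
  refine ⟨r, (hker _ _).2 ?_⟩
  rw [map_sub, hof, hr, sub_self]

namespace IsLocalCompletion

variable {R A : Type*} [CommRing R] [IsLocalRing R] [IsNoetherianRing R]
  [CommRing A] [IsLocalRing A] [Algebra R A]

theorem isArtinianRing_quotient (h : IsLocalCompletion R A) (k : ℕ) :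
    IsArtinianRing (A ⧸ maximalIdeal A ^ k) := by
  rcases Nat.eq_zero_or_pos k with rfl | hk
  · have : Subsingleton (A ⧸ maximalIdeal A ^ 0) := by
      rw [pow_zero, Ideal.one_eq_top]
      exact Ideal.Quotient.subsingleton_iff.2 rfl
    infer_instance
  have hR : IsArtinianRing (R ⧸ maximalIdeal R ^ k) := by
    refine (IsLocalRing.quotient_artinian_of_mem_minimalPrimes_of_isLocalRing _ ?_)
    exact ⟨⟨inferInstance, Ideal.pow_le_self hk.ne'⟩, fun q hq _ => hq.1.le_of_pow_le hq.2⟩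
  let f : R ⧸ maximalIdeal R ^ k →+* A ⧸ maximalIdeal A ^ k :=
    Ideal.quotientMap _ (algebraMap R A) fun r hr => h.map_mem hr
  refine Function.Surjective.isArtinianRing (f := f) fun y => ?_
  obtain ⟨a, rfl⟩ := Ideal.Quotient.mk_surjective y
  obtain ⟨r, hr⟩ := h.exists_sub_mem k a
  exact ⟨Ideal.Quotient.mk _ r, (Ideal.Quotient.eq.2 hr).symm⟩

/-- `(x)` contains a power of the maximal ideal, so the cofactor in `A` may be replaced by a close
element of `R`. -/
theorem dvd_of_map_dvd [IsDomain R] (hdim : ringKrullDim R = 1) (h : IsLocalCompletion R A)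
    {x y : R} (hx : x ≠ 0) (hxy : algebraMap R A x ∣ algebraMap R A y) : x ∣ y := by
  obtain ⟨k, hk⟩ := exists_maximalIdeal_pow_le_span hdim hx
  obtain ⟨a, ha⟩ := hxy
  obtain ⟨r, hr⟩ := h.exists_sub_mem k a
  have h1 : algebraMap R A (y - x * r) ∈ maximalIdeal A ^ k := by
    have := Ideal.mul_mem_left _ (algebraMap R A x) hr
    rwa [mul_sub, ← ha, ← map_mul, ← map_sub] at this
  have h2 := Ideal.mem_span_singleton.1 (hk (h.mem_of_map_mem h1))
  exact (dvd_sub_left (dvd_mul_right x r)).1 h2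

omit [IsNoetherianRing R] in
theorem pow_le_span_of_le (h : IsLocalCompletion R A) {k : ℕ} {x : R}
    (hk : maximalIdeal R ^ k ≤ Ideal.span {x}) :
    maximalIdeal A ^ k ≤ Ideal.span {algebraMap R A x} := by
  rw [h.pow_eq_map, ← Set.image_singleton, ← Ideal.map_span]
  exact Ideal.map_mono hk

theorem exists_le_span [IsDomain R] (hdim : ringKrullDim R = 1) (h : IsLocalCompletion R A)
    {t : R} (ht : t ≠ 0) {I : ℕ → Ideal A} (hI : Antitone I)
    (hmem : ∀ n, algebraMap R A t ^ n ∈ I n)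
    (hinf : ∀ x, (∀ n, x ∈ I n) → x = 0) :
    ∃ n, I n ≤ Ideal.span {algebraMap R A t} := by
  obtain ⟨k, hk⟩ := exists_maximalIdeal_pow_le_span hdim ht
  have := h.isPrecomplete
  obtain ⟨n, hn⟩ := exists_le_pow_of_iInf_eq_bot (maximalIdeal A) h.isArtinianRing_quotient hI
    (fun n => by
      obtain ⟨k, hk⟩ := exists_maximalIdeal_pow_le_span hdim (pow_ne_zero n ht)
      refine ⟨k, (h.pow_le_span_of_le hk).trans ?_⟩
      rw [Ideal.span_singleton_le_iff_mem, map_pow]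
      exact hmem n) hinf k
  exact ⟨n, hn.trans (h.pow_le_span_of_le hk)⟩

omit [IsNoetherianRing R] in
theorem eq_zero_of_forall_pow_dvd (h : IsLocalCompletion R A) {t : R} (htm : t ∈ maximalIdeal R)
    {a : A} (ha : ∀ n, algebraMap R A t ^ n ∣ a) : a = 0 := by
  have := h.isHausdorff
  refine IsHausdorff.haus (I := maximalIdeal A) inferInstance a fun n => ?_
  rw [SModEq.zero]
  have h1 : algebraMap R A t ^ n ∈ maximalIdeal A ^ n := by
    refine Ideal.pow_mem_pow ?_ n
    have := h.map_mem (k := 1) (r := t) (by simpa using htm)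
    simpa using this
  simpa using Ideal.mem_of_dvd _ (ha n) h1

theorem map_ne_zero [IsDomain R] (hdim : ringKrullDim R = 1) (h : IsLocalCompletion R A) {t : R}
    (ht : t ≠ 0) (htm : t ∈ maximalIdeal R) : algebraMap R A t ≠ 0 := by
  intro h0
  have h2 : algebraMap R A (t ^ 2) ∣ algebraMap R A t := by simp [h0]
  obtain ⟨s, hs⟩ := h.dvd_of_map_dvd hdim (pow_ne_zero 2 ht) h2
  have h3 : t * (t * s) = t * 1 := by rw [mul_one, ← mul_assoc, ← sq, ← hs]
  exact htm (IsUnit.of_mul_eq_one _ (mul_left_cancel₀ ht h3))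

/-- A nonzero element of the completion divides a power of any parameter. -/
theorem exists_dvd_pow [IsDomain R] [IsDomain A] (hdim : ringKrullDim R = 1)
    (h : IsLocalCompletion R A) {t : R} (ht : t ≠ 0) (htm : t ∈ maximalIdeal R)
    {a : A} (ha : a ≠ 0) : ∃ c, a ∣ algebraMap R A t ^ c := by
  set τ := algebraMap R A t with hτ
  have hτ0 : τ ≠ 0 := h.map_ne_zero hdim ht htm
  -- Chevalley's theorem for the colon ideals `(τ ^ n : a)`, which meet in zero because `A` is a
  -- domain.
  obtain ⟨c, hc⟩ := h.exists_le_span hdim ht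
    (I := fun n => Submodule.comap (LinearMap.mulLeft A a) (Ideal.span {τ ^ n}))
    (fun m n hmn => Submodule.comap_mono (Ideal.span_singleton_le_span_singleton.2
      (pow_dvd_pow _ hmn)))
    (fun n => Ideal.mem_span_singleton.2 (dvd_mul_left (τ ^ n) a))
    (fun x hx => by
      have : a * x = 0 := h.eq_zero_of_forall_pow_dvd htm fun n => by
        simpa [Ideal.mem_span_singleton] using hx n
      exact (mul_eq_zero.1 this).resolve_left ha)
  have hc' : ∀ b, τ ^ c ∣ a * b → τ ∣ b := fun b hb => Ideal.mem_span_singleton.1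
    (hc (by simpa [Ideal.mem_span_singleton] using hb))
  refine ⟨c, ?_⟩
  obtain ⟨k, hk⟩ := exists_maximalIdeal_pow_le_span hdim (pow_ne_zero (c + 1) ht)
  obtain ⟨r, hr⟩ := h.exists_sub_mem k a
  have hr := Ideal.mem_span_singleton.1 (h.pow_le_span_of_le hk hr)
  rw [map_pow, ← hτ] at hr
  -- the approximation `r` of `a` has the same property
  have hrc : ∀ b, τ ^ c ∣ algebraMap R A r * b → τ ∣ b := fun b hb => hc' b (by
    have h1 : τ ^ c ∣ (a - algebraMap R A r) * b :=
      ((pow_dvd_pow τ (Nat.le_succ c)).trans hr).mul_right b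
    have := dvd_add h1 hb
    rwa [← add_mul, sub_add_cancel] at this)
  have hr0 : r ≠ 0 := by
    rintro rfl
    have h1 := hrc 1 (by simp)
    obtain ⟨s, hs⟩ := h1
    have h2 := h.map_mem (k := 1) (r := t) (by simpa using htm)
    rw [pow_one] at h2
    exact h2 (IsUnit.of_mul_eq_one _ hs.symm)
  obtain ⟨M, hM⟩ : ∃ M, r ∣ t ^ M := by
    obtain ⟨M, hM⟩ := exists_maximalIdeal_pow_le_span hdim hr0
    exact ⟨M, Ideal.mem_span_singleton.1 (hM (Ideal.pow_mem_pow htm M))⟩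
  -- If `r * s = t ^ (c + l + 1)`, then `t` divides `s` and can be cancelled.
  have hdown : ∀ l, r ∣ t ^ (c + l) → r ∣ t ^ c := by
    intro l
    induction l with
    | zero => simp
    | succ l ih =>
      rintro ⟨s, hs⟩
      have h1 : τ ∣ algebraMap R A s := hrc _ (by
        rw [← map_mul, ← hs, map_pow]
        exact pow_dvd_pow τ (by omega))
      obtain ⟨s', rfl⟩ := h.dvd_of_map_dvd hdim ht h1
      refine ih ⟨s', mul_left_cancel₀ ht ?_⟩
      rw [← pow_succ', add_assoc, hs]; ring
  have hrt : r ∣ t ^ c := hdown M (hM.trans (pow_dvd_pow t (Nat.le_add_left M c)))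
  obtain ⟨s, hs⟩ := hrt
  obtain ⟨y, hy⟩ := hr
  -- With `a = r + τ ^ (c + 1) * y` and `r * s = τ ^ c`, the product `a * s` is `τ ^ c` times this
  -- unit.
  have hunit : IsUnit (1 + τ * (y * algebraMap R A s)) := by
    have h2 := h.map_mem (k := 1) (r := t) (by simpa using htm)
    rw [pow_one] at h2
    by_contra hu
    have h3 : (1 + τ * (y * algebraMap R A s)) ∈ maximalIdeal A := hu
    have h4 := sub_mem h3 (Ideal.mul_mem_right (y * algebraMap R A s) _ h2)
    rw [← hτ, add_sub_cancel_right] at h4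
    exact h4 isUnit_one
  rw [← hunit.dvd_mul_right]
  refine ⟨algebraMap R A s, ?_⟩
  have hs' : τ ^ c = algebraMap R A r * algebraMap R A s := by rw [← map_mul, ← hs, map_pow]
  rw [eq_add_of_sub_eq hy]
  linear_combination hs'

/-! ### Divisibility through a dominating valuation -/

/-- If `A` is a domain, divisibility in `R` is a linear order up to a constant factor. -/
theorem exists_dvd_or_dvd_mul [IsDomain R] [IsDomain A] (hdim : ringKrullDim R = 1)
    (h : IsLocalCompletion R A) : ∃ c : R, c ≠ 0 ∧ ∀ x g : R, x ∣ g ∨ g ∣ c * x := by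
  obtain ⟨t, htm, ht⟩ : ∃ t ∈ maximalIdeal R, t ≠ 0 := by
    by_contra! h0
    have h1 : maximalIdeal R = ⊥ := le_bot_iff.1 fun x hx => by simpa using h0 x hx
    have : ringKrullDim R = 0 := ringKrullDim_eq_zero_of_isField
      (IsLocalRing.isField_iff_maximalIdeal_eq.2 h1)
    simp [this] at hdim
  set τ := algebraMap R A t with hτ
  obtain ⟨V, hV, hloc⟩ := IsLocalRing.exists_factor_valuationRing (K := FractionRing A)
    (algebraMap A (FractionRing A))
  let v : Valuation A V.ValueGroup := V.valuation.comap (algebraMap A (FractionRing A))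
  have hv1 : ∀ a, v a ≤ 1 := fun a => (V.valuation_le_one_iff _).2 (hV a)
  have hv0 : ∀ a, v a = 0 ↔ a = 0 := fun a => by
    simp [v]
  have hτm : τ ∈ maximalIdeal A := by
    simpa using h.map_mem (k := 1) (r := t) (by simpa using htm)
  have hτ0 : τ ≠ 0 := h.map_ne_zero hdim ht htm
  have hvτ : v τ < 1 := by
    refine (V.valuation_lt_one_iff ⟨_, hV τ⟩).1 ?_
    exact fun hu => hτm (hloc.map_nonunit τ hu)
  have hanti : ∀ {m n : ℕ}, m ≤ n → v τ ^ n ≤ v τ ^ m := fun hmn =>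
    pow_le_pow_right_of_le_one' (hv1 τ) hmn
  have hvτ0 : 0 < v τ := zero_lt_iff.2 fun h0 => hτ0 ((hv0 τ).1 h0)
  obtain ⟨n, hn⟩ := h.exists_le_span hdim ht
    (I := fun n =>
      { carrier := {a | v a ≤ v τ ^ n}
        add_mem' := fun ha hb => (v.map_add _ _).trans (max_le ha hb)
        zero_mem' := by simp
        smul_mem' := fun a b hb => by
          simp only [Set.mem_ofPred_eq, smul_eq_mul, map_mul]
          exact (mul_le_of_le_one_left' (hv1 a)).trans hb })
    (fun m n hmn a ha => le_trans (show v a ≤ v τ ^ n from ha) (hanti hmn))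
    (fun n => (map_pow v τ n).le)
    -- The value group may have any rank, but a nonzero `a` divides some `τ ^ c`, which bounds `v a`
    -- from below.
    (fun a ha => by
      by_contra ha0
      obtain ⟨c, b, hb⟩ := h.exists_dvd_pow hdim ht htm ha0
      have h1 : v τ ^ c ≤ v a := by
        rw [← map_pow, hb, map_mul]; exact mul_le_of_le_one_right' (hv1 b)
      have h2 : v a ≤ v τ ^ (c + 1) := ha (c + 1)
      have h3 : v τ ^ (c + 1) < v τ ^ c := by
        rw [pow_succ]
        exact mul_lt_of_lt_one_right (pow_pos hvτ0 c) hvτ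
      exact absurd (h1.trans h2) (not_le.2 h3))
  have hdvd : ∀ r : R, v (algebraMap R A r) ≤ v τ ^ n → t ∣ r := fun r hr =>
    h.dvd_of_map_dvd hdim ht (Ideal.mem_span_singleton.1 (hn hr))
  have hdvdpow : ∀ M (r : R), v (algebraMap R A r) ≤ v τ ^ (M + n) → t ^ M ∣ r := by
    intro M
    induction M with
    | zero => simp
    | succ M ih =>
      intro r hr
      obtain ⟨s, rfl⟩ := hdvd r (hr.trans (hanti (by omega)))
      rw [pow_succ']
      refine mul_dvd_mul_left t (ih s ?_)
      rw [map_mul, map_mul, ← hτ, Nat.add_right_comm, pow_succ'] at hr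
      exact le_of_mul_le_mul_left hr hvτ0
  have hkey : ∀ x g : R, x ≠ 0 → v (algebraMap R A g) ≤ v (algebraMap R A x) * v τ ^ n →
      x ∣ g := by
    intro x g hx hg
    obtain ⟨M, hM⟩ := exists_maximalIdeal_pow_le_span hdim hx
    obtain ⟨s, hs⟩ := Ideal.mem_span_singleton.1 (hM (Ideal.pow_mem_pow htm M))
    have hs' : v τ ^ M = v (algebraMap R A x) * v (algebraMap R A s) := by
      rw [← map_mul, ← map_mul, ← hs, map_pow, map_pow]
    obtain ⟨r, hr⟩ := hdvdpow M (g * s) (by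
      rw [map_mul, map_mul, pow_add, hs', mul_right_comm]
      gcongr)
    refine ⟨r, mul_left_cancel₀ (pow_ne_zero M ht) ?_⟩
    calc t ^ M * g = x * (g * s) := by rw [hs]; ring
      _ = t ^ M * (x * r) := by rw [hr]; ring
  -- One factor `t ^ n` makes up for the failed comparison, the other for the loss in `hkey`.
  refine ⟨t ^ (2 * n), pow_ne_zero _ ht, fun x g => ?_⟩
  rcases eq_or_ne x 0 with rfl | hx
  · right; simp
  rcases eq_or_ne g 0 with rfl | hg
  · left; simp
  rcases le_total (v (algebraMap R A g)) (v (algebraMap R A x) * v τ ^ n) with hle | hle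
  · exact Or.inl (hkey x g hx hle)
  · refine Or.inr (hkey g _ hg ?_)
    rw [map_mul, map_mul, map_pow, map_pow, ← hτ, two_mul, pow_add, mul_comm, ← mul_assoc]
    gcongr

end IsLocalCompletion

/-! ### Orders, multiplicities and F-thresholds -/

/-- If `u n * a` and `d n * b` differ by a bounded amount and `d n → ∞`, then `u n / d n → b / a`. -/
theorem tendsto_div_of_bounded_diff {u d : ℕ → ℕ} {a b C : ℕ} (ha : 0 < a)
    (hd : Tendsto d atTop atTop) (h₁ : ∀ n, u n * a ≤ d n * b + C)
    (h₂ : ∀ n, d n * b ≤ u n * a + C) :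
    Tendsto (fun n => (u n : ℝ≥0∞) / (d n : ℕ)) atTop (𝓝 ((b : ℝ≥0∞) / a)) := by
  have ha' : (0 : ℝ) < a := by exact_mod_cast ha
  have hreal : Tendsto (fun n => (u n : ℝ) / d n) atTop (𝓝 ((b : ℝ) / a)) := by
    have hC : Tendsto (fun n => (C : ℝ) / a / (d n : ℝ)) atTop (𝓝 0) :=
      (tendsto_natCast_atTop_atTop.comp hd).const_div_atTop _
    rw [← tendsto_sub_nhds_zero_iff]
    refine squeeze_zero_norm' ?_ hC
    filter_upwards [hd.eventually_gt_atTop 0] with n hn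
    have hn' : (0 : ℝ) < d n := by exact_mod_cast hn
    have h1 : (u n : ℝ) * a ≤ d n * b + C := by exact_mod_cast h₁ n
    have h2 : (d n : ℝ) * b ≤ u n * a + C := by exact_mod_cast h₂ n
    rw [div_sub_div _ _ hn'.ne' ha'.ne', div_div, mul_comm (a : ℝ) (d n : ℝ), Real.norm_eq_abs,
      abs_div, abs_of_pos (mul_pos hn' ha')]
    gcongr
    rw [abs_le]
    constructor <;> linarith
  have h := (ENNReal.continuous_ofReal.tendsto _).comp hreal
  rw [ENNReal.ofReal_div_of_pos ha', ENNReal.ofReal_natCast, ENNReal.ofReal_natCast] at h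
  refine h.congr' ?_
  filter_upwards [hd.eventually_gt_atTop 0] with n hn
  have hn' : (0 : ℝ) < d n := by exact_mod_cast hn
  simp [ENNReal.ofReal_div_of_pos hn']

section Order

variable {R : Type*} [CommRing R] [IsDomain R] [IsNoetherianRing R] [Ring.KrullDimLE 1 R]

/-- The length of `R / (x)` as a natural number. -/
noncomputable def ordNat (x : R) : ℕ := (Ring.ord R x).toNat

theorem natCast_ordNat {x : R} (hx : x ≠ 0) : (ordNat x : ℕ∞) = Ring.ord R x :=
  ENat.natCast_toNat (Ring.ord_ne_top (mem_nonZeroDivisors_of_ne_zero hx))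

theorem ordNat_mul {x y : R} (hx : x ≠ 0) (hy : y ≠ 0) :
    ordNat (x * y) = ordNat x + ordNat y := by
  have h := Ring.ord_mul R (a := x) (mem_nonZeroDivisors_of_ne_zero hy)
  rw [← natCast_ordNat hx, ← natCast_ordNat hy, ← natCast_ordNat (mul_ne_zero hx hy)] at h
  exact_mod_cast h

theorem ordNat_pow {x : R} (hx : x ≠ 0) (n : ℕ) : ordNat (x ^ n) = n * ordNat x := by
  induction n with
  | zero => simp [ordNat]
  | succ n ih => rw [pow_succ, ordNat_mul (pow_ne_zero n hx) hx, ih]; ring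

theorem ordNat_le_of_dvd {x y : R} (hy : y ≠ 0) (h : x ∣ y) : ordNat x ≤ ordNat y := by
  obtain ⟨z, rfl⟩ := h
  rw [ordNat_mul (left_ne_zero_of_mul hy) (right_ne_zero_of_mul hy)]
  exact Nat.le_add_right _ _

theorem ordNat_pos {x : R} (hx : x ≠ 0) (hu : ¬ IsUnit x) : 0 < ordNat x := by
  have h : Ring.ord R x ≠ 0 := by
    rw [Ring.ord, Ne, Module.length_eq_zero_iff, Ideal.Quotient.subsingleton_iff,
      Ideal.span_singleton_eq_top]
    exact hu
  rw [← natCast_ordNat hx] at h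
  exact Nat.pos_of_ne_zero (by exact_mod_cast h)

/-- The least length of `R / (x)` for nonzero `x ∈ I`. -/
noncomputable def minOrd (I : Ideal R) : ℕ := sInf (ordNat '' {x | x ∈ I ∧ x ≠ 0})

omit [IsDomain R] [IsNoetherianRing R] [Ring.KrullDimLE 1 R] in
theorem exists_ordNat_eq_minOrd {I : Ideal R} (hI : I ≠ ⊥) :
    ∃ x ∈ I, x ≠ 0 ∧ ordNat x = minOrd I := by
  obtain ⟨y, hy, hy0⟩ := Submodule.exists_mem_ne_zero_of_ne_bot hI
  obtain ⟨x, ⟨hx, hx0⟩, h⟩ := Nat.sInf_mem (s := ordNat '' {x | x ∈ I ∧ x ≠ 0})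
    ⟨_, y, ⟨hy, hy0⟩, rfl⟩
  exact ⟨x, hx, hx0, h⟩

omit [IsDomain R] [IsNoetherianRing R] [Ring.KrullDimLE 1 R] in
theorem minOrd_le {I : Ideal R} {x : R} (hx : x ∈ I) (hx0 : x ≠ 0) : minOrd I ≤ ordNat x :=
  Nat.sInf_le ⟨x, ⟨hx, hx0⟩, rfl⟩

theorem minOrd_pos {I : Ideal R} (hI : I ≠ ⊥) (hI' : I ≠ ⊤) : 0 < minOrd I := by
  obtain ⟨x, hx, hx0, h⟩ := exists_ordNat_eq_minOrd hI
  rw [← h]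
  exact ordNat_pos hx0 fun hu => hI' (Ideal.eq_top_of_isUnit_mem _ hx hu)

-- Only products, the generators of `I ^ n`, are treated: `ordNat` need not behave like a valuation
-- on sums.
open scoped Pointwise in
theorem le_ordNat_of_mem_set_pow {I : Ideal R} {n : ℕ} {g : R} (hg : g ∈ (I : Set R) ^ n)
    (hg0 : g ≠ 0) : n * minOrd I ≤ ordNat g := by
  induction n generalizing g with
  | zero => simp
  | succ n ih =>
    rw [pow_succ] at hg
    obtain ⟨a, ha, b, hb, rfl⟩ := Set.mem_mul.1 hg
    have ha0 := left_ne_zero_of_mul hg0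
    have hb0 := right_ne_zero_of_mul hg0
    rw [ordNat_mul ha0 hb0, add_mul, one_mul]
    exact add_le_add (ih ha ha0) (minOrd_le hb hb0)

theorem length_quotient_pow_le {I : Ideal R} (hI : I ≠ ⊥) (n : ℕ) :
    Module.length R (R ⧸ I ^ n) ≤ (n * minOrd I : ℕ) := by
  obtain ⟨x, hx, hx0, h⟩ := exists_ordNat_eq_minOrd hI
  rw [← h, ← ordNat_pow hx0, natCast_ordNat (pow_ne_zero n hx0), Ring.ord]
  have hle : Ideal.span {x ^ n} ≤ I ^ n := by
    rw [Ideal.span_singleton_le_iff_mem]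
    exact Ideal.pow_mem_pow hx n
  exact Module.length_le_of_surjective (Submodule.factor hle) (Submodule.factor_surjective hle)

/-- `c` controls divisibility of elements of `R`: divisibility is a linear order up to `c`. -/
def IsDvdBound (c : R) : Prop := c ≠ 0 ∧ ∀ x g : R, x ∣ g ∨ g ∣ c * x

/-- A generator `g` not divisible by `y` would divide `c * y`, and its order would be too small. -/
theorem IsDvdBound.pow_le_span {c : R} (hc : IsDvdBound c) {I : Ideal R} {n : ℕ} {y : R}
    (hy : y ≠ 0) (h : ordNat y + ordNat c < n * minOrd I) : I ^ n ≤ Ideal.span {y} := by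
  rw [Submodule.pow_eq_span_pow_set]
  refine Submodule.span_le.2 fun g hg => ?_
  rcases eq_or_ne g 0 with rfl | hg0
  · exact zero_mem _
  refine Ideal.mem_span_singleton.2 ((hc.2 y g).resolve_right fun hdvd => ?_)
  have h1 := ordNat_le_of_dvd (mul_ne_zero hc.1 hy) hdvd
  rw [ordNat_mul hc.1 hy] at h1
  have := le_ordNat_of_mem_set_pow hg hg0
  omega

theorem IsDvdBound.le_length_quotient_pow {c : R} (hc : IsDvdBound c) {I : Ideal R} (hI : I ≠ ⊥)
    (hI' : I ≠ ⊤) (n : ℕ) :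
    ((n * minOrd I : ℕ) : ℕ∞) ≤
      Module.length R (R ⧸ I ^ n) + ((ordNat c + 1) * minOrd I : ℕ) := by
  have hpos := minOrd_pos hI hI'
  rcases le_or_gt n (ordNat c + 1) with hn | hn
  · exact le_add_left (by exact_mod_cast Nat.mul_le_mul_right _ hn)
  -- Since `minOrd I ≥ 1`, giving up `ordNat c + 1` powers outweighs the error `ordNat c`.
  obtain ⟨N, rfl⟩ := Nat.exists_eq_add_of_le hn.le
  obtain ⟨x, hx, hx0, h⟩ := exists_ordNat_eq_minOrd hI
  have hle : I ^ (ordNat c + 1 + N) ≤ Ideal.span {x ^ N} := hc.pow_le_span (pow_ne_zero N hx0) (by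
    rw [ordNat_pow hx0, h]
    nlinarith)
  have h1 : ((N * minOrd I : ℕ) : ℕ∞) ≤ Module.length R (R ⧸ I ^ (ordNat c + 1 + N)) := by
    rw [← h, ← ordNat_pow hx0, natCast_ordNat (pow_ne_zero N hx0), Ring.ord]
    exact Module.length_le_of_surjective (Submodule.factor hle) (Submodule.factor_surjective hle)
  rw [add_mul, add_comm, Nat.cast_add]
  gcongr

theorem tendsto_hilbertSamuelSeq (hdim : dim R = 1) {c : R} (hc : IsDvdBound c) {I : Ideal R}
    (hI : I ≠ ⊥) (hI' : I ≠ ⊤) : Tendsto (hilbertSamuelSeq I) atTop (𝓝 (minOrd I)) := by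
  have hfin : ∀ n, Module.length R (R ⧸ I ^ n) ≠ ⊤ := fun n =>
    ne_top_of_le_ne_top (ENat.natCast_ne_top _) (length_quotient_pow_le hI n)
  have hlen : ∀ n, ((Module.length R (R ⧸ I ^ n)).toNat : ℕ∞) = Module.length R (R ⧸ I ^ n) :=
    fun n => ENat.natCast_toNat (hfin n)
  have h := tendsto_div_of_bounded_diff (u := fun n => (Module.length R (R ⧸ I ^ n)).toNat)
    (d := fun n => n) (a := 1) (b := minOrd I) (C := (ordNat c + 1) * minOrd I) one_pos tendsto_id
    (fun n => by
      have := length_quotient_pow_le hI n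
      rw [← hlen n] at this
      have : (Module.length R (R ⧸ I ^ n)).toNat ≤ n * minOrd I := by exact_mod_cast this
      omega)
    (fun n => by
      have := hc.le_length_quotient_pow hI hI' n
      rw [← hlen n] at this
      rw [mul_one]
      exact_mod_cast this)
  simp only [Nat.cast_one, div_one] at h
  refine h.congr fun n => ?_
  rw [hilbertSamuelSeq, hdim, ← hlen n]
  simp

omit [IsDomain R] [IsNoetherianRing R] [Ring.KrullDimLE 1 R] in
theorem pow_mem_frobeniusPower {J : Ideal R} {x : R} (hx : x ∈ J) (q : ℕ) :
    x ^ q ∈ frobeniusPower J q :=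
  Ideal.subset_span ⟨x, hx, rfl⟩

omit [IsDomain R] [IsNoetherianRing R] [Ring.KrullDimLE 1 R] in
theorem frobeniusPower_le_pow (J : Ideal R) (q : ℕ) : frobeniusPower J q ≤ J ^ q := by
  refine Ideal.span_le.2 ?_
  rintro _ ⟨x, hx, rfl⟩
  exact Ideal.pow_mem_pow hx q

theorem IsDvdBound.tendsto_nu_div {c : R} (hc : IsDvdBound c) {𝔞 J : Ideal R}
    (ha : 𝔞 ≠ ⊥) (ha' : 𝔞 ≠ ⊤) (hJ : J ≠ ⊥) (hJ' : J ≠ ⊤) {p : ℕ} (hp : 1 < p) :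
    Tendsto (fun e : ℕ => (nu 𝔞 J (p ^ e) : ℝ≥0∞) / (p ^ e : ℕ)) atTop
      (𝓝 ((minOrd J : ℝ≥0∞) / minOrd 𝔞)) := by
  have hapos := minOrd_pos ha ha'
  have hJpos := minOrd_pos hJ hJ'
  obtain ⟨x, hx, hx0, hxa⟩ := exists_ordNat_eq_minOrd ha
  obtain ⟨y, hy, hy0, hyJ⟩ := exists_ordNat_eq_minOrd hJ
  have hset : ∀ q r, ¬ 𝔞 ^ r ≤ frobeniusPower J q →
      r * minOrd 𝔞 ≤ q * minOrd J + ordNat c := by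
    intro q r hr
    by_contra! hlt
    refine hr ((hc.pow_le_span (pow_ne_zero q hy0) ?_).trans
      ((Ideal.span_singleton_le_iff_mem _).2 (pow_mem_frobeniusPower hy q)))
    rwa [ordNat_pow hy0, hyJ]
  -- Boundedness and nonemptiness make the supremum in `nu` a true maximum.
  have hbdd : ∀ q, BddAbove {r : ℕ | ¬ 𝔞 ^ r ≤ frobeniusPower J q} := fun q =>
    ⟨q * minOrd J + ordNat c, fun r hr => (Nat.le_mul_of_pos_right r hapos).trans (hset q r hr)⟩
  have hne : ∀ q, 0 < q → {r : ℕ | ¬ 𝔞 ^ r ≤ frobeniusPower J q}.Nonempty := fun q hq =>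
    ⟨0, fun h => hJ' (top_le_iff.1 (by
      rw [pow_zero, Ideal.one_eq_top] at h
      exact h.trans ((frobeniusPower_le_pow J q).trans (Ideal.pow_le_self hq.ne'))))⟩
  -- In the constant, `minOrd 𝔞` pays for passing from `r` to `r + 1`, the other term for passing
  -- from `q` to `N`.
  refine tendsto_div_of_bounded_diff (C := minOrd 𝔞 + (ordNat c + 1) * minOrd J) hapos
    (tendsto_pow_atTop_atTop_of_one_lt hp) (fun e => ?_) (fun e => ?_)
  · have h1 := hset _ _ (Nat.sSup_mem (hne (p ^ e) (by positivity)) (hbdd (p ^ e)))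
    have h2 : ordNat c ≤ (ordNat c + 1) * minOrd J := by nlinarith
    exact h1.trans (by omega)
  · set q := p ^ e
    set r := nu 𝔞 J q
    have hr : 𝔞 ^ (r + 1) ≤ frobeniusPower J q := by
      by_contra h
      exact absurd (le_csSup (hbdd q) h) (Nat.not_succ_le_self r)
    rcases le_or_gt q (ordNat c + 1) with hq | hq
    · have := Nat.mul_le_mul_right (minOrd J) hq
      omega
    obtain ⟨N, hN⟩ := Nat.exists_eq_add_of_le hq.le
    have hle : J ^ q ≤ Ideal.span {y ^ N} := hc.pow_le_span (pow_ne_zero N hy0) (by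
      rw [ordNat_pow hy0, hyJ, hN]
      nlinarith)
    have h1 : y ^ N ∣ x ^ (r + 1) := Ideal.mem_span_singleton.1
      (hle (frobeniusPower_le_pow J q (hr (Ideal.pow_mem_pow hx (r + 1)))))
    have h2 := ordNat_le_of_dvd (pow_ne_zero _ hx0) h1
    rw [ordNat_pow hy0, ordNat_pow hx0, hxa, hyJ] at h2
    rw [hN]
    nlinarith

end Order

/-! ### Primary ideals and the main theorem -/

theorem IsMPrimary.ne_top {R : Type*} [CommRing R] [IsLocalRing R] {I : Ideal R}
    (hI : IsMPrimary I) : I ≠ ⊤ := hI.1.1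

theorem IsMPrimary.ne_bot {R : Type*} [CommRing R] [IsDomain R] [IsLocalRing R]
    (hdim : ringKrullDim R = 1) {I : Ideal R} (hI : IsMPrimary I) : I ≠ ⊥ := by
  rintro rfl
  have h := hI.2
  rw [Ideal.radical_bot_of_isReduced] at h
  have : ringKrullDim R = 0 := ringKrullDim_eq_zero_of_isField
    (IsLocalRing.isField_iff_maximalIdeal_eq.2 h.symm)
  simp [this] at hdim

theorem IsGeneratedByFullSOP.isMPrimary {R : Type*} [CommRing R] [IsDomain R] [IsLocalRing R]
    [Ring.KrullDimLE 1 R] (hdim : dim R = 1) {J : Ideal R} (hJ : IsGeneratedByFullSOP J) :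
    IsMPrimary J := by
  have hbot : J ≠ ⊥ := by
    rintro rfl
    have h := hJ.2.1
    rw [hdim, Ideal.height_bot] at h
    simp at h
  have hrad : J.radical = maximalIdeal R := by
    refine le_antisymm ((Ideal.radical_mono hJ.1).trans_eq
      (maximalIdeal.isMaximal R).isPrime.radical) ?_
    rw [Ideal.radical_eq_sInf]
    refine le_sInf fun P ⟨hJP, hP⟩ => ?_
    have hP0 : P ≠ ⊥ := fun h => hbot (le_bot_iff.1 (h ▸ hJP))
    exact (eq_maximalIdeal (hP.isMaximal_of_ne_bot hP0)).ge
  exact ⟨Ideal.isPrimary_of_isMaximal_radical (hrad ▸ maximalIdeal.isMaximal R), hrad⟩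

end FThresholds

theorem mainTheorem10 (p : ℕ) [Fact p.Prime] (R : Type*) [CommRing R] [IsDomain R]
    [IsLocalRing R] [IsNoetherianRing R] [CharP R p] (hdim : ringKrullDim R = 1)
    (hirr : FThresholds.IsAnalyticallyIrreducible R) :
    -- the multiplicity of an `𝔪`-primary ideal is a limit, which is positive and finite
    (∀ I : Ideal R, FThresholds.IsMPrimary I →
      Tendsto (FThresholds.hilbertSamuelSeq I) atTop (𝓝 (FThresholds.mult I)) ∧
        0 < FThresholds.mult I ∧ FThresholds.mult I < ∞) ∧
    -- `c^J(𝔞)` exists and is `e(J) / e(𝔞)`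
    (∀ 𝔞 J : Ideal R, FThresholds.IsMPrimary 𝔞 → FThresholds.IsMPrimary J →
      FThresholds.HasFThreshold p 𝔞 J (FThresholds.mult J / FThresholds.mult 𝔞)) ∧
    FThresholds.MultiplicityConjectureHolds p R := by
  have hd : FThresholds.dim R = 1 := by simp [FThresholds.dim, hdim]
  have hdimle : Ring.KrullDimLE 1 R := by
    rw [Ring.KrullDimLE, Order.krullDimLE_iff]
    exact hdim.le
  have : IsDomain (AdicCompletion (IsLocalRing.maximalIdeal R) R) := hirr
  obtain ⟨c, hc⟩ : ∃ c : R, FThresholds.IsDvdBound c :=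
    (FThresholds.isLocalCompletion_adicCompletion R).exists_dvd_or_dvd_mul hdim
  have hlim : ∀ I : Ideal R, FThresholds.IsMPrimary I →
      Tendsto (FThresholds.hilbertSamuelSeq I) atTop (𝓝 (FThresholds.minOrd I : ℝ≥0∞)) :=
    fun I hI => FThresholds.tendsto_hilbertSamuelSeq hd hc (hI.ne_bot hdim) hI.ne_top
  have hmult : ∀ I : Ideal R, FThresholds.IsMPrimary I →
      FThresholds.mult I = FThresholds.minOrd I := fun I hI => (hlim I hI).limUnder_eq
  have hpos : ∀ I : Ideal R, FThresholds.IsMPrimary I → (FThresholds.minOrd I : ℝ≥0∞) ≠ 0 :=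
    fun I hI => Nat.cast_ne_zero.2 (FThresholds.minOrd_pos (hI.ne_bot hdim) hI.ne_top).ne'
  have hthr : ∀ 𝔞 J : Ideal R, FThresholds.IsMPrimary 𝔞 → FThresholds.IsMPrimary J →
      FThresholds.HasFThreshold p 𝔞 J (FThresholds.mult J / FThresholds.mult 𝔞) := by
    intro 𝔞 J ha hJ
    have h := hc.tendsto_nu_div (ha.ne_bot hdim) ha.ne_top (hJ.ne_bot hdim) hJ.ne_top
      (Fact.out (p := p.Prime)).one_lt
    rw [hmult 𝔞 ha, hmult J hJ]
    exact ⟨h.limsup_eq, h.liminf_eq⟩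
  refine ⟨fun I hI => ?_, hthr, fun 𝔞 J ha hJ => ?_⟩
  · rw [hmult I hI]
    exact ⟨hlim I hI, pos_iff_ne_zero.2 (hpos I hI), ENNReal.natCast_lt_top _⟩
  -- For `d = 1` the conjectured inequality is an equality; the cancellations in `ℝ≥0∞` need nonzero
  -- finite multiplicities.
  · have hJ' := hJ.isMPrimary hd
    rw [(hthr 𝔞 J ha hJ').2, hmult 𝔞 ha, hmult J hJ', hd, pow_one, Nat.cast_one, one_div,
      ENNReal.inv_div (Or.inl (ENNReal.natCast_ne_top _)) (Or.inl (hpos 𝔞 ha)),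
      ENNReal.div_mul_cancel (hpos J hJ') (ENNReal.natCast_ne_top _)]
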